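/- Let $n$ and $d$ be integers with $d \ge 1$ and $n \ge 2d+2$, and let $k$ be a field. Let $G = C_n(d+1, d+2, \ldots, \lfloor n/2 \rfloor)$ be the circulant graph on the vertex set $\{0, 1, \ldots, n-1\}$ in which $\{a,b\}$ is an edge if and only if $|a-b|$ or $n-|a-b|$ lies in $\{d+1, d+2, \ldots, \lfloor n/2 \rfloor\}$. Then the following are equivalent: (i) $G$ is Buchsbaum (over $k$); (ii) $G$ is well-covered, i.e. all minimal vertex covers of $G$ have the same cardinality; (iii) $n > 3d$ or $n = 2d+2$. Furthermore, each of the three properties "$G$ is vertex decomposable", "$G$ is shellable" and "$G$ is Cohen–Macaulay (over $k$)" holds if and only if $n = 2d+2$, or $d = 1$ and $n > 3$. Here $G$ is called Buchsbaum, vertex decomposable, shellable or Cohen–Macaulay if its independence complex ${\rm Ind}(G)$, the simplicial complex of all independent sets of $G$, has that property, and for a simplicial complex $\Delta$ on a finite vertex set (with $\emptyset \in \Delta$) the properties are defined as follows. The dimension of a face $F$ is $|F|-1$, and $\dim \Delta$ is the maximum of these; $\Delta$ is pure if all its facets (maximal faces) have the same dimension; ${\rm link}_\Delta(F) = \{H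 \in \Delta : F \cap H = \emptyset,\ F \cup H \in \Delta\}$ for $F \in \Delta$, and ${\rm del}_\Delta(x) = \{H \in \Delta : x \notin H\}$ for a vertex $x$ of $\Delta$; for a vertex one writes ${\rm link}_\Delta(x)$ for ${\rm link}_\Delta(\{x\})$. All four properties require $\Delta$ to be pure. A pure complex $\Delta$ is - vertex decomposable if it is a simplex (all subsets of its vertex set are faces), or if, recursively, it has a vertex $x$ such that ${\rm link}_\Delta(x)$ and ${\rm del}_\Delta(x)$ are vertex decomposable; - shellable if its facets can be ordered $F_1 < \cdots < F_t$ so that for all $1 \le j < i \le t$ there are $x \in F_i \setminus F_j$ and $l \in \{1, \ldots, i-1\}$ with $F_i \setminus F_l = \{x\}$; - Cohen–Macaulay over $k$ if $\tilde H_i({\rm link}_\Delta(F); k) = 0$ for every $F \in \Delta$ and every $i < \dim {\rm link}_\Delta(F)$, where $\tilde H_i$ is reduced simplicial homology; - Buchsbaum over $k$ if ${\rm link}_\Delta(x)$ is Cohen–Macaulay over $k$ for every vertex $x$ of $\Delta$. -/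

import Mathlib

/-- A simplicial complex with finitely many faces, all of them finite sets of elements of `V`:
a family of finite sets closed under taking subsets and containing the empty set.  Its vertices are
the `x` with `{x}` a face; not every element of `V` has to be a vertex, so that links and deletions
are again complexes over the same type `V`.  (Mathlib's `AbstractSimplicialComplex` leaves out the
empty face and makes every element of the type a vertex.) -/
@[ext]
structure FinSimplicialComplex (V : Type*) where
  /-- the faces, including the empty one -/
  faces : Finset (Finset V)
  empty_mem : ∅ ∈ faces
  down_closed : ∀ ⦃F G : Finset V⦄, F ∈ faces → G ⊆ F → G ∈ faces

namespace FinSimplicialComplex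

section Combinatorial

variable {V : Type*}

/-- A facet is a face that is maximal with respect to inclusion. -/
def IsFacet (Δ : FinSimplicialComplex V) (F : Finset V) : Prop :=
  Maximal (fun G => G ∈ Δ.faces) F

/-- All facets have the same dimension. -/
def IsPure (Δ : FinSimplicialComplex V) : Prop :=
  ∀ ⦃F G : Finset V⦄, Δ.IsFacet F → Δ.IsFacet G → F.card = G.card

/-- The dimension, i.e. the maximum of `|F| - 1` over the faces `F`; it is `-1` for the complex
whose only face is the empty set. -/
def dim (Δ : FinSimplicialComplex V) : ℤ :=
  (Δ.faces.sup Finset.card : ℕ) - 1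

/-- A simplex: the faces are all the subsets of one finite set (of the set of all vertices). -/
def IsSimplex (Δ : FinSimplicialComplex V) : Prop :=
  ∃ F : Finset V, Δ.faces = F.powerset

/-- Shellability of a pure complex: the facets can be listed without repetition as
`F 0, F 1, …` so that for all `j < i` there are `x ∈ F i \ F j` and `k < i` with
`F i \ F k = {x}`. -/
def IsShellable [DecidableEq V] (Δ : FinSimplicialComplex V) : Prop :=
  Δ.IsPure ∧
    ∃ (t : ℕ) (F : Fin t → Finset V), Function.Injective F ∧
      (∀ G : Finset V, Δ.IsFacet G ↔ ∃ i, F i = G) ∧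
      ∀ i j : Fin t, j < i → ∃ x ∈ F i \ F j, ∃ k < i, F i \ F k = {x}

/-- The link of a face `F`: the faces `G` disjoint from `F` such that `F ∪ G` is a face. -/
def link [DecidableEq V] (Δ : FinSimplicialComplex V) (F : Finset V) (hF : F ∈ Δ.faces) :
    FinSimplicialComplex V where
  faces := Δ.faces.filter fun G => F ∩ G = ∅ ∧ F ∪ G ∈ Δ.faces
  empty_mem := by simp [Δ.empty_mem, hF]
  down_closed := by
    intro G H hG hHG
    rw [Finset.mem_filter] at hG ⊢
    refine ⟨Δ.down_closed hG.1 hHG, ?_, Δ.down_closed hG.2.2 (Finset.union_subset_union_right hHG)⟩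
    exact Finset.subset_empty.1 (hG.2.1 ▸ Finset.inter_subset_inter_left hHG)

/-- The deletion of a vertex `x`: the faces that do not contain `x`. -/
def deletion [DecidableEq V] (Δ : FinSimplicialComplex V) (x : V) : FinSimplicialComplex V where
  faces := Δ.faces.filter fun G => x ∉ G
  empty_mem := by simp [Δ.empty_mem]
  down_closed := by
    intro G H hG hHG
    rw [Finset.mem_filter] at hG ⊢
    exact ⟨Δ.down_closed hG.1 hHG, fun hx => hG.2 (hHG hx)⟩

/-- Vertex decomposability of a pure complex, defined recursively (a simplex is pure). -/
inductive IsVertexDecomposable [DecidableEq V] : FinSimplicialComplex V → Prop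
  | simplex (Δ : FinSimplicialComplex V) (h : Δ.IsSimplex) : IsVertexDecomposable Δ
  | shed (Δ : FinSimplicialComplex V) (hpure : Δ.IsPure) (x : V) (hx : {x} ∈ Δ.faces)
      (hlink : IsVertexDecomposable (Δ.link {x} hx))
      (hdel : IsVertexDecomposable (Δ.deletion x)) : IsVertexDecomposable Δ

end Combinatorial

section Homology

variable (K : Type*) [Field K] {V : Type*} [LinearOrder V]

/-- The simplicial boundary map on formal linear combinations of finite sets.  If
`F = {x₀ < x₁ < … < xᵢ}`, then `∂ F = ∑ j, (-1) ^ j • (F \ {xⱼ})`; in particular the boundary of a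
one-element set is the empty set, and the boundary of the empty set is `0`. -/
noncomputable def boundary : (Finset V →₀ K) →ₗ[K] (Finset V →₀ K) :=
  Finsupp.linearCombination K fun F =>
    ∑ x ∈ F, Finsupp.single (F.erase x) ((-1 : K) ^ (F.filter (· < x)).card)

theorem boundary_single (F : Finset V) :
    boundary K (Finsupp.single F 1) =
      ∑ x ∈ F, Finsupp.single (F.erase x) ((-1 : K) ^ (F.filter (· < x)).card) := by
  simp [boundary]

theorem boundary_boundary (c : Finset V →₀ K) : boundary K (boundary K c) = 0 := by
  suffices h : boundary K ∘ₗ boundary K = (0 : (Finset V →₀ K) →ₗ[K] (Finset V →₀ K)) from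
    LinearMap.congr_fun h c
  refine Finsupp.lhom_ext' fun F => LinearMap.ext_ring ?_
  simp only [LinearMap.comp_apply, Finsupp.lsingle_apply, boundary_single, map_sum,
    LinearMap.zero_apply]
  have key : ∀ x : V, boundary K (Finsupp.single (F.erase x)
      ((-1 : K) ^ (F.filter (· < x)).card)) = ∑ y ∈ F.erase x, Finsupp.single
        ((F.erase x).erase y) ((-1 : K) ^ (F.filter (· < x)).card *
          (-1 : K) ^ ((F.erase x).filter (· < y)).card) := by
    intro x
    rw [← mul_one ((-1 : K) ^ (F.filter (· < x)).card), ← smul_eq_mul, ← Finsupp.smul_single,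
      map_smul, boundary_single, Finset.smul_sum]
    simp
  simp only [key]
  rw [Finset.sum_sigma']
  -- For `x < y` in `F`, the terms that remove `x, y` in the two orders cancel.
  have cancel : ∀ x ∈ F, ∀ y ∈ F, x < y →
      (-1 : K) ^ (F.filter (· < x)).card * (-1 : K) ^ ((F.erase x).filter (· < y)).card +
      (-1 : K) ^ (F.filter (· < y)).card * (-1 : K) ^ ((F.erase y).filter (· < x)).card = 0 := by
    intro x hx y hy hxy
    have h1 : ((F.erase y).filter (· < x)) = F.filter (· < x) := by
      ext z
      simp only [Finset.mem_filter, Finset.mem_erase]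
      exact ⟨fun h => ⟨h.1.2, h.2⟩, fun h => ⟨⟨(h.2.trans hxy).ne, h.1⟩, h.2⟩⟩
    have h2 : (F.filter (· < y)).card = ((F.erase x).filter (· < y)).card + 1 := by
      rw [Finset.filter_erase, Finset.card_erase_add_one]
      simp [hx, hxy]
    rw [h1, h2, pow_succ]
    ring
  refine Finset.sum_involution (fun p _ => ⟨p.2, p.1⟩) ?_ ?_ ?_ ?_
  · rintro ⟨x, y⟩ hp
    simp only [Finset.mem_sigma, Finset.mem_erase] at hp
    dsimp only
    rw [Finset.erase_right_comm, ← Finsupp.single_add]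
    rcases lt_or_gt_of_ne hp.2.1 with h | h
    · rw [add_comm, cancel y hp.2.2 x hp.1 h, Finsupp.single_zero]
    · rw [cancel x hp.1 y hp.2.2 h, Finsupp.single_zero]
  · rintro ⟨x, y⟩ hp - h
    simp only [Finset.mem_sigma, Finset.mem_erase] at hp
    exact hp.2.1 (congrArg Sigma.fst h)
  · rintro ⟨x, y⟩ hp
    simp only [Finset.mem_sigma, Finset.mem_erase] at hp ⊢
    exact ⟨hp.2.2, hp.2.1.symm, hp.1⟩
  · rintro ⟨x, y⟩ hp
    rfl

variable (Δ : FinSimplicialComplex V)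

/-- The `i`-th augmented simplicial chains of `Δ`: linear combinations of the faces of
dimension `i` (so of the empty face for `i = -1`). -/
def chains (i : ℤ) : Submodule K (Finset V →₀ K) :=
  Finsupp.supported K K {F | F ∈ Δ.faces ∧ (F.card : ℤ) - 1 = i}

/-- The `i`-cycles of the augmented chain complex of `Δ`. -/
noncomputable def cycles (i : ℤ) : Submodule K (Finset V →₀ K) :=
  chains K Δ i ⊓ LinearMap.ker (boundary K)

/-- The `i`-boundaries of the augmented chain complex of `Δ`. -/
noncomputable def boundaries (i : ℤ) : Submodule K (Finset V →₀ K) :=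
  (chains K Δ (i + 1)).map (boundary K)

theorem boundaries_le_cycles (i : ℤ) : boundaries K Δ i ≤ cycles K Δ i := by
  rintro _ ⟨c, hc, rfl⟩
  refine ⟨?_, boundary_boundary K c⟩
  rw [SetLike.mem_coe, chains, Finsupp.mem_supported] at hc
  rw [boundary, Finsupp.linearCombination_apply]
  refine Submodule.sum_mem _ fun F hF => Submodule.smul_mem _ _ (Submodule.sum_mem _ fun x hx => ?_)
  refine Finsupp.single_mem_supported K _ ?_
  obtain ⟨h1, h2⟩ := hc hF
  refine ⟨Δ.down_closed h1 (Finset.erase_subset x F), ?_⟩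
  have := Finset.card_erase_add_one hx
  omega

/-- The quotient `Z / B` for submodules `B ≤ Z` of a module (`B ⊓ Z` takes the place of `B` in
general). -/
abbrev Subquotient {R M : Type*} [Ring R] [AddCommGroup M] [Module R M] (Z B : Submodule R M) :
    Type _ :=
  Z ⧸ B.submoduleOf Z

/-- The `i`-th reduced simplicial homology of `Δ` with coefficients in `K`: cycles modulo
boundaries of the augmented chain complex. -/
abbrev ReducedHomology (i : ℤ) : Type _ :=
  Subquotient (cycles K Δ i) (boundaries K Δ i)

/-- Cohen–Macaulayness over `K` of a pure complex: the reduced homology of the link of every face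
vanishes below the dimension of this link. -/
def IsCohenMacaulay (K : Type*) [Field K] (Δ : FinSimplicialComplex V) : Prop :=
  Δ.IsPure ∧
    ∀ (F : Finset V) (hF : F ∈ Δ.faces) (i : ℤ), i < (Δ.link F hF).dim →
      Subsingleton (ReducedHomology K (Δ.link F hF) i)

/-- Buchsbaumness over `K` of a pure complex: the link of every vertex is Cohen–Macaulay. -/
def IsBuchsbaum (K : Type*) [Field K] (Δ : FinSimplicialComplex V) : Prop :=
  Δ.IsPure ∧ ∀ (x : V) (hx : {x} ∈ Δ.faces), IsCohenMacaulay K (Δ.link {x} hx)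

end Homology

end FinSimplicialComplex

namespace SimpleGraph

/-- A finite graph is well-covered if all its minimal vertex covers have the same cardinality. -/
def IsWellCovered {V : Type*} [Fintype V] (G : SimpleGraph V) : Prop :=
  ∀ ⦃C D : Finset V⦄, Minimal (fun W : Finset V => G.IsVertexCover (W : Set V)) C →
    Minimal (fun W : Finset V => G.IsVertexCover (W : Set V)) D → C.card = D.card

open Classical in
/-- The independence complex: its faces are the independent sets of vertices. -/
noncomputable def independenceComplex {V : Type*} [Fintype V] (G : SimpleGraph V) :
    FinSimplicialComplex V where
  faces := Finset.univ.filter fun W : Finset V => G.IsIndepSet (W : Set V)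
  empty_mem := by simp
  down_closed := by
    intro F W hF hWF
    rw [Finset.mem_filter] at hF ⊢
    exact ⟨Finset.mem_univ _, hF.2.mono (Finset.coe_subset.2 hWF)⟩

/-- The circulant graph `C_n(S)` on `{0, …, n - 1}`: distinct `a` and `b` are adjacent if and only
if `|a - b| ∈ S` or `n - |a - b| ∈ S`.  (For `S ⊆ {1, …, ⌊n / 2⌋}`, as usual, the condition that
`a` and `b` are distinct is automatic.) -/
def circulant (n : ℕ) (S : Set ℕ) : SimpleGraph (Fin n) where
  Adj a b := a ≠ b ∧
    (((a : ℤ) - (b : ℤ)).natAbs ∈ S ∨ n - ((a : ℤ) - (b : ℤ)).natAbs ∈ S)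
  symm := ⟨by
    intro a b h
    rwa [ne_comm, ← Int.natAbs_neg, neg_sub] at h⟩
  loopless := ⟨fun a h => h.1 rfl⟩

end SimpleGraph

/-! A set is independent in `G` exactly when its elements are pairwise at circular distance at most
d, so everything depends on the geometry of such sets. If n > 3d, they are the subsets of the arcs
of d + 1 consecutive elements (`exists_subset_arc`). The complex is therefore pure, and the d + 1
arcs through a vertex, taken in rotating order, shell its link (`isShellable_link_circComplex`).
Hence `G` is Buchsbaum. The complex itself winds around a circle: the cycle through 0, 1, …, n - 1
is not a boundary, because a cocycle counting passages from n - 1 to 0 takes the value -1 on it. For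
d ≥ 2 degree 1 lies below the top dimension, so Cohen–Macaulayness fails
(`not_isCohenMacaulay_circComplex`). For d = 1 the complex is a cycle graph, which is vertex
decomposable. If n = 2d + 2, only opposite elements are adjacent, and the complex is the boundary of
a cross-polytope, vertex decomposable together with its vertex links. If 2d + 3 ≤ n ≤ 3d, there are
facets of different sizes (`not_isPure_circComplex`). The rest is the chain vertex decomposable ⇒
shellable ⇒ Cohen–Macaulay. The second implication is proved directly on chains, by coning off the
facets one at a time. -/

namespace FinSimplicialComplex

/-! ### Cone operators; shellable complexes are Cohen–Macaulay -/

section Homology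

variable (K : Type*) [Field K] {V : Type*} [LinearOrder V]

/-- The cone operator with apex `w`: it joins `w` to the faces that do not contain it. -/
noncomputable def coneMap (w : V) : (Finset V →₀ K) →ₗ[K] (Finset V →₀ K) :=
  Finsupp.linearCombination K fun F =>
    if w ∈ F then 0 else Finsupp.single (insert w F) ((-1 : K) ^ (F.filter (· < w)).card)

theorem coneMap_single (w : V) (F : Finset V) (a : K) :
    coneMap K w (Finsupp.single F a) =
      if w ∈ F then 0 else Finsupp.single (insert w F) (a * (-1 : K) ^ (F.filter (· < w)).card) := by
  rw [coneMap, Finsupp.linearCombination_single]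
  split_ifs <;> simp

theorem boundary_single' (F : Finset V) (a : K) :
    boundary K (Finsupp.single F a) =
      ∑ x ∈ F, Finsupp.single (F.erase x) (a * (-1 : K) ^ (F.filter (· < x)).card) := by
  simp [boundary, Finset.smul_sum]

/-- The sign in front of a face from which `x` is removed after `w` is added is opposite to the
sign for the other order. -/
theorem cone_sign {F : Finset V} {w x : V} (hw : w ∉ F) (hx : x ∈ F) :
    (-1 : K) ^ (F.filter (· < w)).card * (-1 : K) ^ ((insert w F).filter (· < x)).card +
      (-1 : K) ^ (F.filter (· < x)).card * (-1 : K) ^ ((F.erase x).filter (· < w)).card = 0 := by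
  have hne : x ≠ w := fun h => hw (h ▸ hx)
  rcases lt_or_gt_of_ne hne with h | h
  · have h1 : (insert w F).filter (· < x) = F.filter (· < x) := by
      rw [Finset.filter_insert, if_neg h.not_gt]
    have h2 : (F.filter (· < w)).card = ((F.erase x).filter (· < w)).card + 1 := by
      rw [Finset.filter_erase, Finset.card_erase_add_one]
      simp [hx, h]
    rw [h1, h2, pow_succ]
    ring
  · have h1 : ((insert w F).filter (· < x)).card = (F.filter (· < x)).card + 1 := by
      rw [Finset.filter_insert, if_pos h, Finset.card_insert_of_notMem]
      simp [hw]
    have h2 : (F.erase x).filter (· < w) = F.filter (· < w) := by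
      rw [Finset.filter_erase, Finset.erase_eq_of_notMem]
      simp [h.le]
    rw [h1, h2, pow_succ]
    ring

/-- The cone operator is a contracting homotopy of the full simplex. -/
theorem boundary_coneMap_add (w : V) (c : Finset V →₀ K) :
    boundary K (coneMap K w c) + coneMap K w (boundary K c) = c := by
  suffices h : boundary K ∘ₗ coneMap K w + coneMap K w ∘ₗ boundary K = LinearMap.id from
    LinearMap.congr_fun h c
  refine Finsupp.lhom_ext' fun F => LinearMap.ext_ring ?_
  simp only [LinearMap.comp_apply, Finsupp.lsingle_apply, LinearMap.add_apply, LinearMap.id_apply]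
  rw [coneMap_single, boundary_single', map_sum]
  simp only [coneMap_single, one_mul]
  -- If w ∈ F, only the face of F without w survives the cone, and it gives F back. If w ∉ F,
  -- removing w from the cone gives F, and the other terms cancel by `cone_sign`.
  by_cases hw : w ∈ F
  · rw [if_pos hw, map_zero, zero_add, Finset.sum_eq_single w]
    · rw [if_neg (by simp), Finset.insert_erase hw, Finset.filter_erase,
        Finset.erase_eq_of_notMem (by simp), ← mul_pow]
      simp
    · intro x _ hxw
      rw [if_pos (Finset.mem_erase.2 ⟨hxw.symm, hw⟩)]
    · exact fun h => (h hw).elim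
  · rw [if_neg hw, boundary_single', Finset.sum_insert hw, Finset.erase_insert hw, add_assoc,
      ← Finset.sum_add_distrib, Finset.sum_eq_zero, add_zero]
    · rw [Finset.filter_insert, if_neg (lt_irrefl w), ← mul_pow]
      simp
    · intro x hx
      have hne : w ≠ x := fun h => hw (h ▸ hx)
      rw [if_neg fun h => hw (Finset.mem_of_mem_erase h), Finset.erase_insert_of_ne hne,
        ← Finsupp.single_add, cone_sign K hw hx, Finsupp.single_zero]

variable {K}

theorem exists_of_mem_support_coneMap {w : V} {c : Finset V →₀ K} {G : Finset V}
    (hG : G ∈ (coneMap K w c).support) : ∃ F ∈ c.support, w ∉ F ∧ G = insert w F := by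
  by_contra! h
  suffices h' : coneMap K w c ∈ Finsupp.supported K K {H | H ≠ G} from
    (Finsupp.mem_supported K _).1 h' hG rfl
  rw [coneMap, Finsupp.linearCombination_apply]
  refine Submodule.sum_mem _ fun F hF => Submodule.smul_mem _ _ ?_
  split_ifs with hw
  · exact Submodule.zero_mem _
  · exact Finsupp.single_mem_supported K _ (h F hF hw).symm

theorem exists_of_mem_support_boundary {c : Finset V →₀ K} {G : Finset V}
    (hG : G ∈ (boundary K c).support) : ∃ F ∈ c.support, ∃ x ∈ F, G = F.erase x := by
  by_contra! h
  suffices h' : boundary K c ∈ Finsupp.supported K K {H | H ≠ G} from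
    (Finsupp.mem_supported K _).1 h' hG rfl
  rw [boundary, Finsupp.linearCombination_apply]
  refine Submodule.sum_mem _ fun F hF => Submodule.smul_mem _ _ (Submodule.sum_mem _ fun x hx => ?_)
  exact Finsupp.single_mem_supported K _ (h F hF x hx).symm

/-- In a complex whose facets `E i`, for those `i` with `P i`, come in a shelling order, cycles
of less than the top dimension are boundaries. -/
theorem exists_boundary_eq_of_shelling {t : ℕ} {E : Fin t → Finset V} {P : Fin t → Prop} {m : ℕ}
    (hcard : ∀ i, P i → m < (E i).card)
    (hshell : ∀ i j, P i → P j → j < i → ∃ x ∈ E i \ E j, ∃ k < i, P k ∧ E i \ E k = {x})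
    (s : ℕ) (c : Finset V →₀ K) (hc : boundary K c = 0)
    (hsupp : ∀ G ∈ c.support, G.card = m ∧ ∃ l : Fin t, l.1 < s ∧ P l ∧ G ⊆ E l) :
    ∃ b : Finset V →₀ K, boundary K b = c ∧
      ∀ G ∈ b.support, G.card = m + 1 ∧ ∃ l : Fin t, P l ∧ G ⊆ E l := by
  induction s generalizing c with
  | zero =>
    refine ⟨0, ?_, by simp⟩
    rw [map_zero, eq_comm, ← Finsupp.support_eq_empty, Finset.eq_empty_iff_forall_notMem]
    intro G hG
    obtain ⟨-, l, hl, -⟩ := hsupp G hG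
    exact absurd hl (Nat.not_lt_zero _)
  | succ s ih =>
    by_cases hs : ∃ h : s < t, P ⟨s, h⟩
    swap
    · refine ih c hc fun G hG => ?_
      obtain ⟨h1, l, h2, h3, h4⟩ := hsupp G hG
      refine ⟨h1, l, lt_of_le_of_ne (Nat.lt_succ_iff.1 h2) ?_, h3, h4⟩
      rintro rfl
      exact hs ⟨l.2, h3⟩
    obtain ⟨hst, hP⟩ := hs
    set i : Fin t := ⟨s, hst⟩
    -- `old G` says that `G` is a face of the subcomplex of the earlier facets.
    let old : Finset V → Prop := fun G => ∃ l : Fin t, l.1 < s ∧ P l ∧ G ⊆ E l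
    have old_mono : ∀ {G H : Finset V}, G ⊆ H → old H → old G :=
      fun h ⟨l, h1, h2, h3⟩ => ⟨l, h1, h2, h.trans h3⟩
    -- `R x` says that the codimension-one face of `E i` opposite to x is old. If this holds for all
    -- x in `E i`, every proper subset of `E i` is old, and the facet contributes nothing in degrees
    -- below the top. Otherwise the old faces of `E i` form a cone with apex any w violating `R`.
    let R : V → Prop := fun x => ∃ k < i, P k ∧ E i \ E k = {x}
    by_cases hR : ∃ w ∈ E i, ¬ R w
    swap
    · push Not at hR
      refine ih c hc fun G hG => ?_
      obtain ⟨h1, l, h2, h3, h4⟩ := hsupp G hG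
      refine ⟨h1, ?_⟩
      rcases Nat.lt_succ_iff_lt_or_eq.1 h2 with h2 | h2
      · exact ⟨l, h2, h3, h4⟩
      · obtain rfl : l = i := Fin.ext h2
        obtain ⟨x, hx, hxG⟩ := Finset.exists_mem_notMem_of_card_lt_card (h1 ▸ hcard _ hP)
        obtain ⟨k, hk, hPk, hk'⟩ := hR x hx
        refine ⟨k, hk, hPk, fun y hy => ?_⟩
        by_contra hyk
        have : y ∈ E i \ E k := Finset.mem_sdiff.2 ⟨h4 hy, hyk⟩
        rw [hk', Finset.mem_singleton] at this
        exact hxG (this ▸ hy)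
    obtain ⟨w, hwE, hwR⟩ := hR
    have new_sub : ∀ G ∈ c.support, ¬ old G → G ⊆ E i := by
      intro G hG hGo
      obtain ⟨h1, l, h2, h3, h4⟩ := hsupp G hG
      rcases Nat.lt_succ_iff_lt_or_eq.1 h2 with h2 | h2
      · exact (hGo ⟨l, h2, h3, h4⟩).elim
      · obtain rfl : l = i := Fin.ext h2
        exact h4
    -- Joining `w` to a face of `E i` keeps it old.
    have old_insert : ∀ G, G ⊆ E i → old G → old (insert w G) := by
      rintro G hGE ⟨j, hj, hPj, hGj⟩
      obtain ⟨x, hx, k, hk, hPk, hk'⟩ := hshell i j hP hPj hj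
      refine ⟨k, hk, hPk, fun y hy => ?_⟩
      by_contra hyk
      have hyE : y ∈ E i := (Finset.insert_subset hwE hGE) hy
      have hyx : y ∈ E i \ E k := Finset.mem_sdiff.2 ⟨hyE, hyk⟩
      rw [hk', Finset.mem_singleton] at hyx
      rcases Finset.mem_insert.1 hy with h | h
      · exact hwR ⟨k, hk, hPk, by rw [hk', ← hyx, h]⟩
      · exact (Finset.mem_sdiff.1 hx).2 (hyx ▸ hGj h)
    classical
    set c₁ := c.filter fun G => ¬ old G with hc₁
    set c₀ := c.filter old with hc₀
    have hsum : c₀ + c₁ = c := Finsupp.filter_add_filter_not c old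
    have hsupp₁ : ∀ G ∈ c₁.support, G ∈ c.support ∧ ¬ old G := fun G hG => by
      rwa [hc₁, Finsupp.support_filter, Finset.mem_filter] at hG
    have hsupp₀ : ∀ G ∈ c₀.support, G ∈ c.support ∧ old G := fun G hG => by
      rwa [hc₀, Finsupp.support_filter, Finset.mem_filter] at hG
    have hbd : boundary K c₁ = - boundary K c₀ := by
      rw [eq_neg_iff_add_eq_zero, add_comm, ← map_add, hsum, hc]
    have hbd_old : ∀ G ∈ (boundary K c₁).support, G ⊆ E i ∧ old G ∧ G.card + 1 = m := by
      intro G hG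
      obtain ⟨F, hF, x, hx, hGF⟩ := exists_of_mem_support_boundary hG
      have hF' := hsupp₁ F hF
      refine ⟨hGF ▸ (Finset.erase_subset x F).trans (new_sub F hF'.1 hF'.2), ?_, ?_⟩
      · rw [hbd, Finsupp.support_neg] at hG
        obtain ⟨F, hF, x, hx, rfl⟩ := exists_of_mem_support_boundary hG
        exact old_mono (Finset.erase_subset x F) (hsupp₀ F hF).2
      · rw [hGF, Finset.card_erase_add_one hx, (hsupp F hF'.1).1]
    -- Thus c = ∂(cone c₁) + (c₀ + cone(∂c₁)). Since c is a cycle, ∂c₁ = -∂c₀ is old, and coning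
    -- with w keeps it old, so the bracket is an old cycle and the induction hypothesis applies.
    have hcone := boundary_coneMap_add K w c₁
    obtain ⟨b, hb, hbs⟩ := ih (c₀ + coneMap K w (boundary K c₁))
      (by
        have h := congrArg (boundary K) hcone
        rw [map_add, boundary_boundary, zero_add] at h
        rw [map_add, h, ← map_add, hsum, hc])
      (by
        intro G hG
        rcases Finset.mem_union.1 (Finsupp.support_add hG) with hG | hG
        · exact ⟨(hsupp G (hsupp₀ G hG).1).1, (hsupp₀ G hG).2⟩
        · obtain ⟨F, hF, hwF, rfl⟩ := exists_of_mem_support_coneMap hG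
          obtain ⟨h1, h2, h3⟩ := hbd_old F hF
          exact ⟨by rw [Finset.card_insert_of_notMem hwF, h3], old_insert F h1 h2⟩)
    refine ⟨b + coneMap K w c₁, ?_, fun G hG => ?_⟩
    · rw [map_add, hb, add_assoc, add_comm (coneMap K w _), hcone, hsum]
    · rcases Finset.mem_union.1 (Finsupp.support_add hG) with hG | hG
      · exact hbs G hG
      · obtain ⟨F, hF, hwF, rfl⟩ := exists_of_mem_support_coneMap hG
        have hF' := hsupp₁ F hF
        exact ⟨by rw [Finset.card_insert_of_notMem hwF, (hsupp F hF'.1).1], i, hP,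
          Finset.insert_subset hwE (new_sub F hF'.1 hF'.2)⟩

theorem exists_isFacet_of_mem {V : Type*} {Δ : FinSimplicialComplex V} {G : Finset V} (hG : G ∈ Δ.faces) :
    ∃ F, Δ.IsFacet F ∧ G ⊆ F := by
  obtain ⟨F, h1, h2⟩ := Δ.faces.exists_le_maximal hG
  exact ⟨F, h2, h1⟩

theorem mem_link {V : Type*} [DecidableEq V] {Δ : FinSimplicialComplex V} {F G : Finset V}
    (hF : F ∈ Δ.faces) : G ∈ (Δ.link F hF).faces ↔ Disjoint F G ∧ F ∪ G ∈ Δ.faces := by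
  rw [link, Finset.mem_filter, ← Finset.disjoint_iff_inter_eq_empty]
  exact ⟨fun h => h.2, fun h => ⟨Δ.down_closed h.2 Finset.subset_union_right, h⟩⟩

theorem subsingleton_reducedHomology_iff (Δ : FinSimplicialComplex V) (i : ℤ) :
    Subsingleton (ReducedHomology K Δ i) ↔ cycles K Δ i ≤ boundaries K Δ i :=
  Submodule.Quotient.subsingleton_iff.trans Submodule.submoduleOf_eq_top

/-- Shellable complexes are Cohen–Macaulay over every field. -/
theorem IsShellable.isCohenMacaulay {Δ : FinSimplicialComplex V} (h : Δ.IsShellable) :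
    Δ.IsCohenMacaulay K := by
  obtain ⟨hpure, t, F, -, hF, hshell⟩ := h
  refine ⟨hpure, fun A hA i hi => ?_⟩
  rw [subsingleton_reducedHomology_iff]
  rintro c ⟨hc, hbc⟩
  rw [SetLike.mem_coe, chains, Finsupp.mem_supported] at hc
  have hface : ∀ j, F j ∈ Δ.faces := fun j => ((hF _).2 ⟨j, rfl⟩).prop
  by_cases hi0 : i + 1 < 0
  · have : c = 0 := by
      rw [← Finsupp.support_eq_empty, Finset.eq_empty_iff_forall_notMem]
      intro G hG
      have := (hc hG).2
      omega
    rw [this]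
    exact Submodule.zero_mem _
  -- m = i + 1 is the number of elements of a face of dimension i.
  obtain ⟨m, hm⟩ := Int.eq_ofNat_of_zero_le (not_lt.1 hi0)
  have hcov : ∀ G ∈ (Δ.link A hA).faces, ∃ j, A ⊆ F j ∧ G ⊆ F j \ A := by
    intro G hG
    rw [mem_link] at hG
    obtain ⟨H, hH, hGH⟩ := exists_isFacet_of_mem hG.2
    obtain ⟨j, rfl⟩ := (hF H).1 hH
    refine ⟨j, Finset.subset_union_left.trans hGH, Finset.subset_sdiff.2
      ⟨Finset.subset_union_right.trans hGH, hG.1.symm⟩⟩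
  -- The facets of the link of A are the `F j \ A` with `A ⊆ F j`. They inherit the shelling order:
  -- when both `F j` and `F l` contain A, the exchanged x lies outside A, so the intermediate `F k`
  -- contains A as well.
  refine Exists.elim (exists_boundary_eq_of_shelling (E := fun j => F j \ A)
    (P := fun j => A ⊆ F j) (m := m) ?_ ?_ t c hbc ?_) ?_
  · intro j hj
    have hsup : (Δ.link A hA).faces.sup Finset.card ≤ (F j \ A).card := by
      refine Finset.sup_le fun G hG => ?_
      obtain ⟨l, hl, hGl⟩ := hcov G hG
      refine (Finset.card_le_card hGl).trans ?_
      rw [Finset.card_sdiff_of_subset hl, Finset.card_sdiff_of_subset hj,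
        hpure ((hF _).2 ⟨j, rfl⟩) ((hF _).2 ⟨l, rfl⟩)]
    rw [dim] at hi
    change m < (F j \ A).card
    omega
  · intro j l hj hl hlj
    obtain ⟨x, hx, k, hk, hjk⟩ := hshell j l hlj
    rw [Finset.mem_sdiff] at hx
    have hxA : x ∉ A := fun h => hx.2 (hl h)
    refine ⟨x, by simp [hx, hxA], k, hk, fun y hy => ?_, ?_⟩
    · by_contra hyk
      have : y ∈ F j \ F k := Finset.mem_sdiff.2 ⟨hj hy, hyk⟩
      rw [hjk, Finset.mem_singleton] at this
      exact hxA (this ▸ hy)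
    · ext y
      have := Finset.ext_iff.1 hjk y
      simp only [Finset.mem_sdiff, Finset.mem_singleton] at this ⊢
      grind
  · intro G hG
    obtain ⟨h1, h2⟩ := hc hG
    obtain ⟨j, h3, h4⟩ := hcov G h1
    exact ⟨by omega, j, j.2, h3, h4⟩
  · rintro b ⟨hb, hbs⟩
    refine ⟨b, ?_, hb⟩
    rw [SetLike.mem_coe, chains, Finsupp.mem_supported]
    intro G hG
    obtain ⟨h1, j, h2, h3⟩ := hbs G hG
    refine ⟨?_, by rw [h1]; push_cast; omega⟩
    rw [Finset.subset_sdiff] at h3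
    rw [mem_link]
    exact ⟨h3.2.symm, Δ.down_closed (hface j) (Finset.union_subset h2 h3.1)⟩

end Homology

end FinSimplicialComplex

/-! ### Vertex decomposability: shellings, and complexes given by an involution -/

namespace FinSimplicialComplex

variable {V : Type*} [DecidableEq V]

theorem mem_deletion {Δ : FinSimplicialComplex V} {x : V} {G : Finset V} :
    G ∈ (Δ.deletion x).faces ↔ G ∈ Δ.faces ∧ x ∉ G := by
  rw [deletion, Finset.mem_filter]

theorem mem_link_singleton {Δ : FinSimplicialComplex V} {x : V} (hx : {x} ∈ Δ.faces)
    {G : Finset V} : G ∈ (Δ.link {x} hx).faces ↔ x ∉ G ∧ insert x G ∈ Δ.faces := by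
  rw [mem_link, Finset.disjoint_singleton_left, Finset.insert_eq]

theorem isFacet_link_singleton {Δ : FinSimplicialComplex V} {x : V} (hx : {x} ∈ Δ.faces)
    {G : Finset V} : (Δ.link {x} hx).IsFacet G ↔ x ∉ G ∧ Δ.IsFacet (insert x G) := by
  constructor
  · rintro ⟨h1, h2⟩
    rw [mem_link_singleton] at h1
    refine ⟨h1.1, h1.2, fun H hH hGH => ?_⟩
    have hxH : x ∈ H := hGH (Finset.mem_insert_self x G)
    have := @h2 (H.erase x)
      (by simpa [mem_link_singleton, Finset.insert_erase hxH] using hH)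
      (by
        intro y hy
        exact Finset.mem_erase.2 ⟨fun h => h1.1 (h ▸ hy), hGH (Finset.mem_insert_of_mem hy)⟩)
    rw [← Finset.insert_erase hxH]
    exact Finset.insert_subset_insert x this
  · rintro ⟨h1, h2, h3⟩
    refine ⟨(mem_link_singleton hx).2 ⟨h1, h2⟩, fun H hH hGH => ?_⟩
    replace hH := (mem_link_singleton hx).1 hH
    have := h3 hH.2 (Finset.insert_subset_insert x hGH)
    exact (Finset.insert_subset_insert_iff hH.1).1 this

theorem IsPure.link_singleton {Δ : FinSimplicialComplex V} (h : Δ.IsPure) {x : V}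
    (hx : {x} ∈ Δ.faces) : (Δ.link {x} hx).IsPure := by
  intro F G hF hG
  rw [isFacet_link_singleton] at hF hG
  have := h hF.2 hG.2
  rwa [Finset.card_insert_of_notMem hF.1, Finset.card_insert_of_notMem hG.1,
    Nat.add_right_cancel_iff] at this

theorem IsSimplex.isFacet_iff {V : Type*} {Δ : FinSimplicialComplex V} {F : Finset V}
    (h : Δ.faces = F.powerset) {G : Finset V} : Δ.IsFacet G ↔ F = G := by
  simp only [IsFacet, h, Finset.mem_powerset]
  constructor
  · exact fun hG => (hG.eq_of_le le_rfl hG.prop).symm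
  · rintro rfl
    exact ⟨le_rfl, fun H hH _ => hH⟩

theorem IsSimplex.isShellable {Δ : FinSimplicialComplex V} (h : Δ.IsSimplex) :
    Δ.IsShellable := by
  obtain ⟨F, hF⟩ := h
  refine ⟨fun G H hG hH => ?_, 1, fun _ => F, fun _ _ _ => Subsingleton.elim _ _, fun G => ?_, ?_⟩
  · rw [IsSimplex.isFacet_iff hF] at hG hH
    rw [← hG, ← hH]
  · simp [IsSimplex.isFacet_iff hF]
  · intro i j hij
    omega

/-- Pure vertex decomposable complexes are shellable: list the facets that avoid the shedding
vertex `x` before those that contain it. -/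
theorem IsVertexDecomposable.isShellable {Δ : FinSimplicialComplex V}
    (h : Δ.IsVertexDecomposable) : Δ.IsShellable := by
  induction h with
  | simplex Δ h => exact h.isShellable
  | shed Δ hpure x hx _ _ hlink hdel =>
    obtain ⟨-, t₂, F₂, hinj₂, hF₂, hsh₂⟩ := hlink
    have hx₂ : ∀ i, x ∉ F₂ i := fun i => ((isFacet_link_singleton hx).1 ((hF₂ _).2 ⟨i, rfl⟩)).1
    have hsd : ∀ i j, insert x (F₂ i) \ insert x (F₂ j) = F₂ i \ F₂ j := by
      intro i j
      rw [Finset.insert_sdiff_insert, Finset.sdiff_insert_of_notMem (hx₂ i)]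
    have hinj : Function.Injective fun i => insert x (F₂ i) := by
      intro i j hij
      apply hinj₂
      rw [← Finset.erase_insert (hx₂ i), ← Finset.erase_insert (hx₂ j)]
      exact congrArg (fun s => Finset.erase s x) hij
    have hfacet : ∀ G, (Δ.IsFacet G ∧ x ∈ G) ↔ ∃ i, insert x (F₂ i) = G := by
      intro G
      constructor
      · rintro ⟨hG, hxG⟩
        obtain ⟨i, hi⟩ := (hF₂ (G.erase x)).1
          ((isFacet_link_singleton hx).2 ⟨by simp, by rwa [Finset.insert_erase hxG]⟩)
        exact ⟨i, by rw [hi, Finset.insert_erase hxG]⟩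
      · rintro ⟨i, rfl⟩
        exact ⟨((isFacet_link_singleton hx).1 ((hF₂ _).2 ⟨i, rfl⟩)).2, by simp⟩
    have hsh : ∀ i j, j < i → ∃ y ∈ insert x (F₂ i) \ insert x (F₂ j), ∃ k < i,
        insert x (F₂ i) \ insert x (F₂ k) = {y} := by
      intro i j hij
      simpa only [hsd] using hsh₂ i j hij
    -- If x lies in every facet, `Δ` is a cone over the link; no facet of the deletion is then a
    -- facet of `Δ`, and the link alone supplies the list.
    by_cases hall : ∀ G, Δ.IsFacet G → x ∈ G
    · refine ⟨hpure, t₂, fun i => insert x (F₂ i), hinj, fun G => ?_, hsh⟩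
      rw [← hfacet]
      exact ⟨fun hG => ⟨hG, hall G hG⟩, fun hG => hG.1⟩
    push Not at hall
    obtain ⟨G₀, hG₀, hxG₀⟩ := hall
    obtain ⟨hpure₁, t₁, F₁, hinj₁, hF₁, hsh₁⟩ := hdel
    have hdel_of : ∀ G, Δ.IsFacet G → x ∉ G → (Δ.deletion x).IsFacet G := fun G hG hxG =>
      ⟨mem_deletion.2 ⟨hG.1, hxG⟩, fun H hH hGH => hG.2 (mem_deletion.1 hH).1 hGH⟩
    -- The facet `G₀` of `Δ` is also a facet of the deletion. As both complexes are pure, their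
    -- facets have the same size, so a facet of the deletion cannot be enlarged in `Δ`.
    have hfacet₁ : ∀ G, (Δ.IsFacet G ∧ x ∉ G) ↔ ∃ i, F₁ i = G := by
      intro G
      rw [← hF₁]
      refine ⟨fun h => hdel_of G h.1 h.2, fun hG => ?_⟩
      have hG' := mem_deletion.1 hG.prop
      refine ⟨?_, hG'.2⟩
      obtain ⟨H, hH, hGH⟩ := exists_isFacet_of_mem hG'.1
      have hc : G.card = H.card := by
        rw [hpure₁ hG (hdel_of G₀ hG₀ hxG₀), hpure hG₀ hH]
      rwa [Finset.eq_of_subset_of_card_le hGH hc.ge]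
    have hx₁ : ∀ i, x ∉ F₁ i := fun i => ((hfacet₁ _).2 ⟨i, rfl⟩).2
    refine ⟨hpure, t₁ + t₂, Fin.append F₁ fun i => insert x (F₂ i), ?_, fun G => ?_, ?_⟩
    · rw [Fin.append_injective_iff]
      refine ⟨hinj₁, hinj, fun i j hij => hx₁ i ?_⟩
      rw [hij]
      simp
    · constructor
      · intro hG
        by_cases hxG : x ∈ G
        · obtain ⟨i, hi⟩ := (hfacet G).1 ⟨hG, hxG⟩
          exact ⟨Fin.natAdd t₁ i, by rwa [Fin.append_right]⟩
        · obtain ⟨i, hi⟩ := (hfacet₁ G).1 ⟨hG, hxG⟩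
          exact ⟨Fin.castAdd t₂ i, by rwa [Fin.append_left]⟩
      · rintro ⟨i, hi⟩
        induction i using Fin.addCases with
        | left i =>
          rw [Fin.append_left] at hi
          exact ((hfacet₁ G).2 ⟨i, hi⟩).1
        | right i =>
          rw [Fin.append_right] at hi
          exact ((hfacet G).2 ⟨i, hi⟩).1
    · intro i j hij
      induction i using Fin.addCases with
      | left i =>
        induction j using Fin.addCases with
        | left j =>
          obtain ⟨y, hy, k, hk, hik⟩ := hsh₁ i j hij
          refine ⟨y, by simpa only [Fin.append_left] using hy, Fin.castAdd t₂ k, hk, ?_⟩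
          simpa only [Fin.append_left] using hik
        | right j =>
          simp only [Fin.lt_def, Fin.val_natAdd, Fin.val_castAdd] at hij
          omega
      | right i =>
        induction j using Fin.addCases with
        | left j =>
          simp only [Fin.append_left, Fin.append_right]
          -- Without x, the facet `insert x (F₂ i)` becomes a face of the deletion, hence lies in
          -- some earlier `F₁ k`; only x is lost.
          refine ⟨x, by simp [hx₁], ?_⟩
          have hface : F₂ i ∈ (Δ.deletion x).faces := mem_deletion.2
            ⟨Δ.down_closed ((hfacet _).2 ⟨i, rfl⟩).1.prop (Finset.subset_insert _ _), hx₂ i⟩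
          obtain ⟨H, hH, hiH⟩ := exists_isFacet_of_mem hface
          obtain ⟨k, rfl⟩ := (hF₁ H).1 hH
          refine ⟨Fin.castAdd t₂ k, ?_, ?_⟩
          · simp only [Fin.lt_def, Fin.val_natAdd, Fin.val_castAdd]
            omega
          · rw [Fin.append_left, Finset.insert_sdiff_of_notMem _ (hx₁ k),
              Finset.sdiff_eq_empty_iff_subset.2 hiH]
            rfl
        | right j =>
          have hij' : j < i := by
            simp only [Fin.lt_def, Fin.val_natAdd] at hij ⊢
            omega
          obtain ⟨y, hy, k, hk, hik⟩ := hsh i j hij'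
          refine ⟨y, by simpa only [Fin.append_right] using hy, Fin.natAdd t₁ k, ?_, ?_⟩
          · simp only [Fin.lt_def, Fin.val_natAdd] at hk ⊢
            omega
          · simpa only [Fin.append_right] using hik

/-- Let `σ` be an involution without fixed points.  The subsets of `U` that contain no pair
`{x, σ x}` form a vertex decomposable complex. -/
theorem isVertexDecomposable_of_involution {σ : V → V} (hσ : Function.Involutive σ)
    (hfix : ∀ x, σ x ≠ x) (U : Finset V) (Δ : FinSimplicialComplex V)
    (hΔ : ∀ W, W ∈ Δ.faces ↔ W ⊆ U ∧ ∀ x ∈ W, σ x ∉ W) : Δ.IsVertexDecomposable := by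
  induction hU : U.card using Nat.strong_induction_on generalizing U Δ with
  | _ N ih =>
  by_cases hpair : ∃ x ∈ U, σ x ∈ U
  swap
  · push Not at hpair
    refine .simplex Δ ⟨U, Finset.ext fun W => ?_⟩
    rw [hΔ, Finset.mem_powerset]
    exact ⟨fun h => h.1, fun h => ⟨h, fun x hx hσx => hpair x (h hx) (h hσx)⟩⟩
  obtain ⟨x, hxU, hσxU⟩ := hpair
  have hxf : {x} ∈ Δ.faces := by
    rw [hΔ]
    simp [hxU, hfix]
  have hpure : Δ.IsPure := by
    -- By maximality a facet F meets every pair {y, σ y} with y in U, and in one element only. So F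
    -- and σ(F) partition U ∪ σ(U), which fixes |F|.
    have key : ∀ F, Δ.IsFacet F → F.card + F.card = (U ∪ U.image σ).card := by
      intro F hF
      obtain ⟨hFU, hFσ⟩ := (hΔ F).1 hF.prop
      have hcov : ∀ y ∈ U, y ∈ F ∨ σ y ∈ F := by
        intro y hy
        by_contra! h
        refine h.1 (hF.2 ((hΔ (insert y F)).2 ⟨Finset.insert_subset hy hFU, ?_⟩)
          (Finset.subset_insert y F) (Finset.mem_insert_self y F))
        intro z hz hσz
        rcases Finset.mem_insert.1 hz with rfl | hz
        · rcases Finset.mem_insert.1 hσz with h' | h'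
          · exact hfix _ h'
          · exact h.2 h'
        · rcases Finset.mem_insert.1 hσz with h' | h'
          · rw [← h', hσ z] at h
            exact h.2 hz
          · exact hFσ z hz h'
      have hun : U ∪ U.image σ = F ∪ F.image σ := by
        ext y
        simp only [Finset.mem_union, Finset.mem_image]
        constructor
        · rintro (hy | ⟨z, hz, rfl⟩)
          · rcases hcov y hy with h | h
            · exact Or.inl h
            · exact Or.inr ⟨σ y, h, hσ y⟩
          · rcases hcov z hz with h | h
            · exact Or.inr ⟨z, h, rfl⟩
            · exact Or.inl h
        · rintro (hy | ⟨z, hz, rfl⟩)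
          · exact Or.inl (hFU hy)
          · exact Or.inr ⟨z, hFU hz, rfl⟩
      rw [hun, Finset.card_union_of_disjoint, Finset.card_image_of_injective _ hσ.injective]
      rw [Finset.disjoint_left]
      intro y hy hy'
      obtain ⟨z, hz, rfl⟩ := Finset.mem_image.1 hy'
      exact hFσ z hz hy
    intro F G hF hG
    have := key F hF
    have := key G hG
    omega
  have hlt : (U.erase x).card < N := hU ▸ Finset.card_erase_lt_of_mem hxU
  -- The link of x is the complex on U without x and σ x, the deletion the one on U without x. The
  -- latter leaves σ x unpaired, which is why U need not be stable under σ.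
  refine .shed Δ hpure x hxf
    (ih _ (lt_of_le_of_lt (Finset.card_erase_le (a := σ x)) hlt) ((U.erase x).erase (σ x)) _ ?_ rfl)
    (ih _ hlt (U.erase x) _ ?_ rfl)
  · intro W
    rw [mem_link_singleton, hΔ, Finset.subset_erase, Finset.subset_erase, Finset.insert_subset_iff]
    constructor
    · rintro ⟨h1, ⟨-, h2⟩, h3⟩
      refine ⟨⟨⟨h2, h1⟩, fun h => h3 x (by simp) (by simp [h])⟩, fun y hy hσy => ?_⟩
      exact h3 y (by simp [hy]) (by simp [hσy])
    · rintro ⟨⟨⟨h1, h2⟩, h3⟩, h4⟩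
      refine ⟨h2, ⟨hxU, h1⟩, fun y hy hσy => ?_⟩
      rcases Finset.mem_insert.1 hy with rfl | hy
      · rcases Finset.mem_insert.1 hσy with h | h
        · exact hfix _ h
        · exact h3 h
      · rcases Finset.mem_insert.1 hσy with h | h
        · exact h3 (by rwa [← h, hσ y])
        · exact h4 y hy h
  · intro W
    rw [mem_deletion, hΔ, Finset.subset_erase]
    tauto

end FinSimplicialComplex

/-! ### Complexes with an explicit family of facets -/

namespace FinSimplicialComplex

variable {V : Type*}

theorem isPure_of_cover {Δ : FinSimplicialComplex V} {ι : Type*} {F : ι → Finset V} {m : ℕ}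
    (hF : ∀ i, F i ∈ Δ.faces) (hcard : ∀ i, (F i).card = m)
    (hcov : ∀ G ∈ Δ.faces, ∃ i, G ⊆ F i) : Δ.IsPure := by
  have key : ∀ G, Δ.IsFacet G → G.card = m := by
    intro G hG
    obtain ⟨i, hi⟩ := hcov G hG.prop
    rw [hG.eq_of_le (hF i) hi, hcard]
  intro G H hG hH
  rw [key G hG, key H hH]

theorem isFacet_iff_of_cover {Δ : FinSimplicialComplex V} {ι : Type*} {F : ι → Finset V}
    (hF : ∀ i, F i ∈ Δ.faces) (hanti : ∀ i j, F i ⊆ F j → i = j)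
    (hcov : ∀ G ∈ Δ.faces, ∃ i, G ⊆ F i) (G : Finset V) : Δ.IsFacet G ↔ ∃ i, F i = G := by
  constructor
  · intro hG
    obtain ⟨i, hi⟩ := hcov G hG.prop
    exact ⟨i, (hG.eq_of_le (hF i) hi).symm⟩
  · rintro ⟨i, rfl⟩
    refine ⟨hF i, fun H hH hiH => ?_⟩
    obtain ⟨j, hj⟩ := hcov H hH
    rwa [hanti i j (hiH.trans hj)]

/-- At most two points form a vertex decomposable complex. -/
theorem isVertexDecomposable_of_two_points [DecidableEq V] {Δ : FinSimplicialComplex V} {a b : V}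
    (hpure : Δ.IsPure) (hab : a ≠ b) (hΔ : ∀ W, W ∈ Δ.faces ↔ W ⊆ {a} ∨ W ⊆ {b}) :
    Δ.IsVertexDecomposable := by
  have ha : {a} ∈ Δ.faces := (hΔ _).2 (Or.inl subset_rfl)
  refine .shed Δ hpure a ha (.simplex _ ⟨∅, ?_⟩) (.simplex _ ⟨{b}, ?_⟩)
  · ext W
    rw [mem_link_singleton, hΔ, Finset.mem_powerset, Finset.subset_empty, Finset.insert_subset_iff,
      Finset.insert_subset_iff, Finset.subset_singleton_iff]
    constructor
    · rintro ⟨h1, ⟨-, rfl | rfl⟩ | ⟨h2, -⟩⟩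
      · rfl
      · simp at h1
      · exact (hab (Finset.mem_singleton.1 h2)).elim
    · rintro rfl
      simp
  · ext W
    rw [mem_deletion, hΔ, Finset.mem_powerset, Finset.subset_singleton_iff,
      Finset.subset_singleton_iff]
    constructor
    · rintro ⟨(rfl | rfl) | h, h1⟩
      · simp
      · simp at h1
      · exact h
    · rintro (rfl | rfl)
      · simp
      · simp [hab]

end FinSimplicialComplex

/-! ### The independence complex of the circulant graph: arcs, cross-polytopes and cycles -/

namespace SimpleGraph

open FinSimplicialComplex

theorem mem_independenceComplex {V : Type*} [Fintype V] {G : SimpleGraph V} {W : Finset V} :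
    W ∈ G.independenceComplex.faces ↔ G.IsIndepSet (W : Set V) := by
  simp [independenceComplex]

/-- The minimal vertex covers are the complements of the maximal independent sets. -/
theorem minimal_isVertexCover_compl_iff {V : Type*} [Fintype V] [DecidableEq V]
    {G : SimpleGraph V} {W : Finset V} :
    Minimal (fun C : Finset V => G.IsVertexCover (C : Set V)) Wᶜ ↔
      G.independenceComplex.IsFacet W := by
  have key : ∀ C : Finset V, G.IsVertexCover (C : Set V) ↔ Cᶜ ∈ G.independenceComplex.faces := by
    intro C
    rw [mem_independenceComplex, Finset.coe_compl, isIndepSet_compl_iff_isVertexCover]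
  simp only [FinSimplicialComplex.IsFacet, Minimal, Maximal, key, compl_compl]
  refine and_congr_right fun _ => ⟨fun h H hH hWH => ?_, fun h C hC hCW => ?_⟩
  · have := @h Hᶜ (by rwa [compl_compl]) (compl_le_compl hWH)
    exact compl_le_compl_iff_le.1 this
  · exact compl_le_iff_compl_le.1 (h hC (le_compl_comm.1 hCW))

theorem isWellCovered_iff_isPure {V : Type*} [Fintype V] {G : SimpleGraph V} :
    G.IsWellCovered ↔ G.independenceComplex.IsPure := by
  classical
  constructor
  · intro h F H hF hH
    have := h (minimal_isVertexCover_compl_iff.2 hF) (minimal_isVertexCover_compl_iff.2 hH)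
    rw [Finset.card_compl, Finset.card_compl] at this
    have := F.card_le_univ
    have := H.card_le_univ
    omega
  · intro h C D hC hD
    rw [← compl_compl C, minimal_isVertexCover_compl_iff] at hC
    rw [← compl_compl D, minimal_isVertexCover_compl_iff] at hD
    have := h hC hD
    rw [Finset.card_compl, Finset.card_compl] at this
    have := C.card_le_univ
    have := D.card_le_univ
    omega

/-- The circular distance of `a` and `b` in `{0, …, n - 1}` is at most `d`. -/
def CircClose (n d a b : ℕ) : Prop :=
  (a ≤ b + d ∧ b ≤ a + d) ∨ a + n ≤ b + d ∨ b + n ≤ a + d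

/-- The element `x` is one of `s, s + 1, …, s + d` modulo `n`. -/
def InArc (n d s x : ℕ) : Prop :=
  (s ≤ x ∧ x ≤ s + d) ∨ x + n ≤ s + d

instance (n d s x : ℕ) : Decidable (InArc n d s x) := by
  unfold InArc
  infer_instance

/-- The independence complex of the circulant graph whose edges join the elements of circular
distance more than `d`. -/
noncomputable abbrev circComplex (n d : ℕ) : FinSimplicialComplex (Fin n) :=
  (circulant n (Set.Icc (d + 1) (n / 2))).independenceComplex

/-- The smaller of |a - b| and n - |a - b| is at most n / 2 automatically, so adjacency only says
that this circular distance exceeds d. -/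
theorem mem_circComplex {n d : ℕ} {W : Finset (Fin n)} :
    W ∈ (circComplex n d).faces ↔ ∀ a ∈ W, ∀ b ∈ W, CircClose n d a b := by
  rw [mem_independenceComplex, isIndepSet_iff, Set.Pairwise]
  have key : ∀ a b : Fin n, CircClose n d a b ↔ (a ≠ b →
      ¬ (circulant n (Set.Icc (d + 1) (n / 2))).Adj a b) := by
    intro a b
    simp only [circulant, CircClose, Set.mem_Icc, ne_eq, Fin.ext_iff]
    omega
  simp only [key, Finset.mem_coe]

/-- The arc `{s, s + 1, …, s + d}` modulo `n`. -/
def arc (n d : ℕ) (s : Fin n) : Finset (Fin n) :=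
  Finset.univ.filter fun x => InArc n d s x

theorem mem_arc {n d : ℕ} {s x : Fin n} : x ∈ arc n d s ↔ InArc n d s x := by
  simp [arc]

theorem card_arc {n d : ℕ} (h : d < n) (s : Fin n) : (arc n d s).card = d + 1 := by
  rw [← Finset.card_range (d + 1)]
  -- The bijection sends x to its forward offset from s modulo n.
  refine Finset.card_bij' (fun x _ => if s.1 ≤ x.1 then x.1 - s.1 else n + x.1 - s.1)
    (fun k hk => ⟨if s.1 + k < n then s.1 + k else s.1 + k - n, ?_⟩) ?_ ?_ ?_ ?_
  · rw [Finset.mem_range] at hk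
    split_ifs <;> omega
  · intro x hx
    rw [mem_arc, InArc] at hx
    rw [Finset.mem_range]
    split_ifs <;> omega
  · intro k hk
    rw [Finset.mem_range] at hk
    rw [mem_arc, InArc]
    dsimp only
    split_ifs <;> omega
  · intro x hx
    rw [mem_arc, InArc] at hx
    rw [Fin.ext_iff]
    dsimp only
    split_ifs <;> omega
  · intro k hk
    rw [Finset.mem_range] at hk
    dsimp only
    split_ifs <;> omega

theorem arc_mem_circComplex {n d : ℕ} (s : Fin n) : arc n d s ∈ (circComplex n d).faces := by
  rw [mem_circComplex]
  intro a ha b hb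
  rw [mem_arc, InArc] at ha hb
  rw [CircClose]
  omega

/-- If `3 * d < n`, then pairwise close elements lie on an arc. -/
theorem exists_subset_arc {n d : ℕ} (h : 3 * d < n) {W : Finset (Fin n)}
    (hW : W ∈ (circComplex n d).faces) {v : Fin n} (hv : v ∈ W) : ∃ s, W ⊆ arc n d s := by
  rw [mem_circComplex] at hW
  -- Take s in W farthest behind v, within distance d. Elements of W behind v then lie between s and
  -- v. One ahead of v is at most 2d steps ahead of s; since n - d > 2d, closeness to s forces at
  -- most d steps.
  obtain ⟨s, hs, hmax⟩ := Finset.exists_max_image (W.filter fun s : Fin n => InArc n d s v)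
    (fun s : Fin n => if s.1 ≤ v.1 then v.1 - s.1 else n + v.1 - s.1)
    ⟨v, by simp [hv, InArc]⟩
  rw [Finset.mem_filter] at hs
  refine ⟨s, fun w hw => mem_arc.2 ?_⟩
  have h1 := hmax w
  have h2 := hW s hs.1 w hw
  have h3 := hW v hv w hw
  have h4 := hs.2
  simp only [Finset.mem_filter, hw, true_and] at h1
  simp only [InArc, CircClose] at *
  split_ifs at h1 <;> omega

theorem circComplex_isPure {n d : ℕ} (h : 3 * d < n) : (circComplex n d).IsPure := by
  refine isPure_of_cover (F := arc n d) arc_mem_circComplex (card_arc (by omega)) fun G hG => ?_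
  rcases G.eq_empty_or_nonempty with rfl | ⟨v, hv⟩
  · exact ⟨⟨0, by omega⟩, Finset.empty_subset _⟩
  · exact exists_subset_arc h hG hv

/-- If `2 * d + 3 ≤ n ≤ 3 * d`, there is the facet `{0, …, d}` and the smaller facet
`{0, d} ∪ {n - d, …, 2 * d}`. -/
theorem not_isPure_circComplex {n d : ℕ} (h1 : 2 * d + 3 ≤ n) (h2 : n ≤ 3 * d) :
    ¬ (circComplex n d).IsPure := by
  intro hpure
  have hA : (circComplex n d).IsFacet (arc n d ⟨0, by omega⟩) := by
    refine ⟨arc_mem_circComplex _, fun H hH hAH v hv => ?_⟩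
    replace hH := mem_circComplex.1 hH
    rw [mem_arc, InArc]
    -- Closeness to d gives v ≤ 2d. If v > d, then v - (d + 1) is in the arc at circular distance d
    -- + 1 from v, a contradiction. For v ≤ d the truncated difference is 0, which is harmless.
    have h3 := hH v hv ⟨v - (d + 1), by omega⟩
    have h4 := hH v hv ⟨d, by omega⟩ (hAH (by rw [mem_arc, InArc]; simp))
    have h5 := hH v hv ⟨0, by omega⟩ (hAH (by rw [mem_arc, InArc]; simp))
    have h6 : v.1 ≤ 2 * d + 1 → _ := fun h => h3 (hAH (by rw [mem_arc, InArc]; dsimp only; omega))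
    simp only [CircClose] at h4 h5 h6
    dsimp only
    omega
  set B : Finset (Fin n) := Finset.univ.filter fun x =>
    x.1 = 0 ∨ x.1 = d ∨ (n ≤ x.1 + d ∧ x.1 ≤ 2 * d) with hBdef
  have memB : ∀ x : Fin n, x ∈ B ↔ x.1 = 0 ∨ x.1 = d ∨ (n ≤ x.1 + d ∧ x.1 ≤ 2 * d) := by
    simp [hBdef]
  have hB : (circComplex n d).IsFacet B := by
    refine ⟨mem_circComplex.2 fun a ha b hb => ?_, fun H hH hBH v hv => ?_⟩
    · rw [memB] at ha hb
      rw [CircClose]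
      omega
    · replace hH := mem_circComplex.1 hH
      rw [memB]
      have h3 := hH v hv ⟨0, by omega⟩ (hBH (by rw [memB]; simp))
      have h4 := hH v hv ⟨d, by omega⟩ (hBH (by rw [memB]; simp))
      -- Closeness to 0 and d leaves only the candidates 0 < v < d outside B. Closeness to n - d
      -- gives v ≥ n - 2d, and then v + d + 1 lies in B at circular distance d + 1 from v.
      have h5 := hH v hv ⟨n - d, by omega⟩ (hBH (by rw [memB]; dsimp only; omega))
      have h6 : v.1 < d → n ≤ v.1 + 2 * d + 1 → CircClose n d v.1 (v.1 + d + 1) :=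
        fun h h' => hH v hv ⟨v.1 + d + 1, by omega⟩ (hBH (by rw [memB]; dsimp only; omega))
      simp only [CircClose] at h3 h4 h5 h6
      omega
  have hc := hpure hA hB
  rw [card_arc (by omega)] at hc
  -- This bounds |B| by 2 + (3d + 1 - n), which is at most d because n ≥ 2d + 3.
  have hsub : B.map Fin.valEmbedding ⊆ {0, d} ∪ Finset.Icc (n - d) (2 * d) := by
    intro y hy
    obtain ⟨x, hx, rfl⟩ := Finset.mem_map.1 hy
    rw [memB] at hx
    simp only [Fin.valEmbedding_apply, Finset.mem_union, Finset.mem_insert, Finset.mem_singleton,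
      Finset.mem_Icc]
    omega
  have hle := (Finset.card_le_card hsub).trans (Finset.card_union_le _ _)
  have h2 : ({0, d} : Finset ℕ).card ≤ 2 := Finset.card_le_two
  rw [Finset.card_map, Nat.card_Icc] at hle
  omega

/-- If `3 * d < n`, the link of a vertex `v` is shellable: its facets are the arcs through `v`,
without `v`, in the order in which they rotate. -/
theorem isShellable_link_circComplex {n d : ℕ} (h : 3 * d < n) (v : Fin n)
    (hv : {v} ∈ (circComplex n d).faces) : ((circComplex n d).link {v} hv).IsShellable := by
  -- `F i` is the arc from v - i to v + (d - i) without v. The four alternatives are: behind v,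
  -- behind v across 0, ahead of v, ahead of v across 0.
  let F : Fin (d + 1) → Finset (Fin n) := fun i => Finset.univ.filter fun x =>
    x ≠ v ∧ ((x.1 ≤ v.1 ∧ v.1 ≤ x.1 + i.1) ∨ v.1 + n ≤ x.1 + i.1 ∨
      (v.1 ≤ x.1 ∧ x.1 + i.1 ≤ v.1 + d) ∨ x.1 + n + i.1 ≤ v.1 + d)
  have memF : ∀ (i : Fin (d + 1)) (x : Fin n), x ∈ F i ↔ x.1 ≠ v.1 ∧
      ((x.1 ≤ v.1 ∧ v.1 ≤ x.1 + i.1) ∨ v.1 + n ≤ x.1 + i.1 ∨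
      (v.1 ≤ x.1 ∧ x.1 + i.1 ≤ v.1 + d) ∨ x.1 + n + i.1 ≤ v.1 + d) := by
    intro i x
    simp [F, Fin.ext_iff]
  have hface : ∀ i, F i ∈ ((circComplex n d).link {v} hv).faces := by
    intro i
    rw [mem_link_singleton]
    refine ⟨fun h => ((memF _ _).1 h).1 rfl, ?_⟩
    rw [mem_circComplex]
    have key : ∀ a ∈ insert v (F i), (a.1 ≤ v.1 ∧ v.1 ≤ a.1 + i.1) ∨ v.1 + n ≤ a.1 + i.1 ∨
      (v.1 ≤ a.1 ∧ a.1 + i.1 ≤ v.1 + d) ∨ a.1 + n + i.1 ≤ v.1 + d := by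
      intro a ha
      rcases Finset.mem_insert.1 ha with rfl | ha
      · omega
      · exact ((memF _ _).1 ha).2
    intro a ha b hb
    have := key a ha
    have := key b hb
    rw [CircClose]
    omega
  have hanti : ∀ i j, F i ⊆ F j → i = j := by
    intro i j hij
    rw [Fin.ext_iff]
    apply le_antisymm
    · by_contra! hlt
      -- The two ends of the arc separate the sets: v - i is not in `F j` for j < i, and v + (d - i)
      -- is not in `F j` for j > i.
      have := (memF j ⟨if i.1 ≤ v.1 then v.1 - i.1 else n + v.1 - i.1, by split_ifs <;> omega⟩).1
        (hij ((memF _ _).2 (by dsimp only; split_ifs <;> omega)))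
      dsimp only at this
      split_ifs at this <;> omega
    · by_contra! hlt
      have := (memF j ⟨if v.1 + (d - i.1) < n then v.1 + (d - i.1) else v.1 + (d - i.1) - n,
        by split_ifs <;> omega⟩).1
        (hij ((memF _ _).2 (by dsimp only; split_ifs <;> omega)))
      dsimp only at this
      split_ifs at this <;> omega
  have hcov : ∀ G ∈ ((circComplex n d).link {v} hv).faces, ∃ i, G ⊆ F i := by
    intro G hG
    rw [mem_link_singleton] at hG
    obtain ⟨s, hs⟩ := exists_subset_arc h hG.2 (Finset.mem_insert_self v G)
    have hsv := mem_arc.1 (hs (Finset.mem_insert_self v G))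
    rw [InArc] at hsv
    refine ⟨⟨if s.1 ≤ v.1 then v.1 - s.1 else n + v.1 - s.1, by split_ifs <;> omega⟩,
      fun x hx => ?_⟩
    have hx1 : x.1 ≠ v.1 := fun h => hG.1 (Fin.ext h ▸ hx)
    have hx2 := mem_arc.1 (hs (Finset.mem_insert_of_mem hx))
    rw [InArc] at hx2
    rw [memF]
    refine ⟨hx1, ?_⟩
    dsimp only
    split_ifs <;> omega
  refine ⟨(circComplex_isPure h).link_singleton hv, d + 1, F, fun i j hij => hanti i j hij.subset,
    fun G => isFacet_iff_of_cover hface hanti hcov G, fun i j hij => ?_⟩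
  rw [Fin.lt_def] at hij
  -- Each rotation step adds the single element v - i, which no earlier arc contains; so k = i - 1
  -- serves for every j.
  refine ⟨⟨if i.1 ≤ v.1 then v.1 - i.1 else n + v.1 - i.1, by split_ifs <;> omega⟩, ?_,
    ⟨i.1 - 1, by omega⟩, by rw [Fin.lt_def]; dsimp only; omega, ?_⟩
  · rw [Finset.mem_sdiff, memF, memF]
    dsimp only
    split_ifs <;> omega
  · ext x
    rw [Finset.mem_sdiff, memF, memF, Finset.mem_singleton, Fin.ext_iff]
    dsimp only
    split_ifs <;> omega

/-- The map that takes each element of `{0, …, 2 * d + 1}` to the opposite one. -/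
def antipode (d : ℕ) (x : Fin (2 * d + 2)) : Fin (2 * d + 2) :=
  ⟨if x.1 ≤ d then x.1 + (d + 1) else x.1 - (d + 1), by split_ifs <;> omega⟩

theorem antipode_involutive (d : ℕ) : Function.Involutive (antipode d) := by
  intro x
  rw [Fin.ext_iff]
  simp only [antipode]
  split_ifs <;> omega

theorem antipode_ne {d : ℕ} (x : Fin (2 * d + 2)) : antipode d x ≠ x := by
  rw [ne_eq, Fin.ext_iff]
  simp only [antipode]
  split_ifs <;> omega

/-- On 2d + 2 points the largest circular distance is d + 1, attained only by opposite points. -/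
theorem circClose_iff_ne_antipode {d : ℕ} (a b : Fin (2 * d + 2)) :
    CircClose (2 * d + 2) d a b ↔ antipode d a ≠ b := by
  rw [ne_eq, Fin.ext_iff]
  simp only [antipode, CircClose]
  split_ifs <;> omega

theorem mem_circComplex_antipode {d : ℕ} {W : Finset (Fin (2 * d + 2))} :
    W ∈ (circComplex (2 * d + 2) d).faces ↔ ∀ x ∈ W, antipode d x ∉ W := by
  rw [mem_circComplex]
  simp only [circClose_iff_ne_antipode]
  exact ⟨fun h x hx hx' => h x hx _ hx' rfl, fun h a ha b hb hab => h a ha (hab ▸ hb)⟩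

theorem isVertexDecomposable_crossPolytope (d : ℕ) :
    (circComplex (2 * d + 2) d).IsVertexDecomposable :=
  isVertexDecomposable_of_involution (antipode_involutive d) antipode_ne Finset.univ _ fun W => by
    simp [mem_circComplex_antipode]

/-- The link of v is again a cross-polytope boundary, on the d pairs that do not contain v. -/
theorem isVertexDecomposable_link_crossPolytope {d : ℕ} {v : Fin (2 * d + 2)}
    (hv : {v} ∈ (circComplex (2 * d + 2) d).faces) :
    ((circComplex (2 * d + 2) d).link {v} hv).IsVertexDecomposable := by
  refine isVertexDecomposable_of_involution (antipode_involutive d) antipode_ne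
    (Finset.univ.filter fun x => x ≠ v ∧ x ≠ antipode d v) _ fun W => ?_
  rw [mem_link_singleton, mem_circComplex_antipode]
  rw [Finset.forall_mem_insert]
  simp only [Finset.mem_insert, not_or, Finset.subset_iff,
    Finset.mem_filter, Finset.mem_univ, true_and]
  constructor
  · rintro ⟨h1, ⟨-, h2⟩, h3⟩
    exact ⟨fun x hx => ⟨fun h => h1 (h ▸ hx), fun h => h2 (h ▸ hx)⟩, fun x hx => (h3 x hx).2⟩
  · rintro ⟨h1, h2⟩
    refine ⟨fun h => (h1 h).1 rfl, ⟨antipode_ne v, fun h => (h1 h).2 rfl⟩, fun x hx => ⟨?_, h2 x hx⟩⟩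
    intro h
    refine (h1 hx).2 ?_
    rw [← h, antipode_involutive d x]

/-- The path on `{0, …, m - 1}`, as a complex, is vertex decomposable. -/
theorem isVertexDecomposable_path {n : ℕ} (m : ℕ) (hm : m ≤ n) (Δ : FinSimplicialComplex (Fin n))
    (hΔ : ∀ W, W ∈ Δ.faces ↔ ∀ a ∈ W, a.1 < m ∧ ∀ b ∈ W, a.1 ≤ b.1 + 1) :
    Δ.IsVertexDecomposable := by
  induction m generalizing Δ with
  | zero =>
    refine .simplex _ ⟨∅, ?_⟩
    ext W
    rw [hΔ, Finset.mem_powerset]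
    exact ⟨fun h x hx => absurd (h x hx).1 (Nat.not_lt_zero _),
      fun h x hx => absurd (h hx) (Finset.notMem_empty x)⟩
  | succ m ih =>
    -- A path on at most two vertices is a simplex; a longer one is pure with its edges as facets.
    by_cases hm2 : m < 2
    · refine .simplex _ ⟨Finset.univ.filter fun x => x.1 < m + 1, ?_⟩
      ext W
      rw [hΔ, Finset.mem_powerset]
      simp only [Finset.subset_iff, Finset.mem_filter, Finset.mem_univ, true_and]
      refine ⟨fun h x hx => (h x hx).1, fun h x hx => ⟨h hx, fun b hb => ?_⟩⟩
      have := h hx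
      omega
    have hpure : Δ.IsPure := by
      refine isPure_of_cover (ι := Fin m) (m := 2)
        (F := fun i => {⟨i.1, by omega⟩, ⟨i.1 + 1, by omega⟩}) ?_ ?_ ?_
      · intro i
        rw [hΔ]
        intro a ha
        simp only [Finset.mem_insert, Finset.mem_singleton, Fin.ext_iff] at ha ⊢
        refine ⟨by omega, fun b hb => by omega⟩
      · intro i
        rw [Finset.card_pair]
        simp
      · intro G hG
        rw [hΔ] at hG
        rcases G.eq_empty_or_nonempty with rfl | hne
        · exact ⟨⟨0, by omega⟩, Finset.empty_subset _⟩
        obtain ⟨a, ha, hmin⟩ := Finset.exists_min_image G (fun x => x.1) hne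
        have ha' := hG a ha
        -- The edge starts at the least element of G, or one earlier if that element is the last
        -- vertex m.
        refine ⟨⟨min a.1 (m - 1), by omega⟩, fun x hx => ?_⟩
        have h1 := hmin x hx
        have h2 := hG x hx
        have h3 := h2.2 a ha
        simp only [Finset.mem_insert, Finset.mem_singleton, Fin.ext_iff]
        omega
    have hxm : {⟨m, by omega⟩} ∈ Δ.faces := by
      rw [hΔ]
      simp
    refine .shed Δ hpure ⟨m, by omega⟩ hxm (.simplex _ ⟨{⟨m - 1, by omega⟩}, ?_⟩)
      (ih (by omega) _ ?_)
    · ext W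
      rw [mem_link_singleton, hΔ, Finset.mem_powerset]
      constructor
      · rintro ⟨h1, h2⟩ x hx
        have h3 := h2 x (Finset.mem_insert_of_mem hx)
        have h4 := (h2 ⟨m, by omega⟩ (Finset.mem_insert_self _ _)).2 x (Finset.mem_insert_of_mem hx)
        have h5 : x.1 ≠ m := by
          rintro rfl
          exact h1 hx
        rw [Finset.mem_singleton, Fin.ext_iff]
        dsimp only at h4 ⊢
        omega
      · intro h
        have h' : ∀ x ∈ W, x.1 = m - 1 := fun x hx => by
          simpa [Fin.ext_iff] using h hx
        refine ⟨fun hx => ?_, fun a ha => ?_⟩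
        · have := h' _ hx
          dsimp only at this
          omega
        · have key : ∀ x ∈ insert (⟨m, by omega⟩ : Fin n) W, x.1 = m ∨ x.1 = m - 1 := by
            intro x hx
            rcases Finset.mem_insert.1 hx with rfl | hx
            · exact Or.inl rfl
            · exact Or.inr (h' x hx)
          have := key a ha
          refine ⟨by omega, fun b hb => ?_⟩
          have := key b hb
          omega
    · intro W
      rw [mem_deletion, hΔ]
      constructor
      · rintro ⟨h1, h2⟩ a ha
        refine ⟨lt_of_le_of_ne (Nat.lt_succ_iff.1 (h1 a ha).1) ?_, (h1 a ha).2⟩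
        rintro rfl
        exact h2 ha
      · intro h
        exact ⟨fun a ha => ⟨(h a ha).1.trans (Nat.lt_succ_self m), (h a ha).2⟩,
          fun h' => lt_irrefl _ (h _ h').1⟩

/-- For `n ≥ 4` the cycle on `{0, …, n - 1}`, as a complex, is vertex decomposable. -/
theorem isVertexDecomposable_cycle {n : ℕ} (hn : 3 < n) :
    (circComplex n 1).IsVertexDecomposable := by
  have hpure : (circComplex n 1).IsPure := circComplex_isPure (by omega)
  have hx : {⟨n - 1, by omega⟩} ∈ (circComplex n 1).faces := by
    rw [mem_circComplex]
    simp [CircClose]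
    omega
  -- The link of n - 1 consists of its neighbours 0 and n - 2, which are not close since n ≥ 4. Its
  -- deletion is a path, since every pair that wraps around involves n - 1.
  refine .shed _ hpure ⟨n - 1, by omega⟩ hx
    (isVertexDecomposable_of_two_points (a := ⟨0, by omega⟩) (b := ⟨n - 2, by omega⟩)
      (hpure.link_singleton hx) ?_ ?_)
    (isVertexDecomposable_path (n - 1) (by omega) _ ?_)
  · rw [ne_eq, Fin.ext_iff]
    dsimp only
    omega
  · intro W
    rw [mem_link_singleton, mem_circComplex]
    constructor
    · rintro ⟨h1, h2⟩
      have key : ∀ x ∈ W, x.1 = 0 ∨ x.1 = n - 2 := by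
        intro x hx
        have h3 := h2 _ (Finset.mem_insert_self _ _) x (Finset.mem_insert_of_mem hx)
        have h4 : x.1 ≠ n - 1 := fun h => h1 (by
          convert hx
          exact h.symm)
        simp only [CircClose] at h3
        omega
      by_cases h0 : ⟨0, by omega⟩ ∈ W
      · left
        intro x hx
        have h3 := h2 _ (Finset.mem_insert_of_mem h0) x (Finset.mem_insert_of_mem hx)
        have h4 := key x hx
        simp only [CircClose] at h3
        rw [Finset.mem_singleton, Fin.ext_iff]
        dsimp only
        omega
      · right
        intro x hx
        have h3 : x.1 ≠ 0 := fun h => h0 (by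
          convert hx
          exact h.symm)
        rw [Finset.mem_singleton, Fin.ext_iff]
        exact (key x hx).resolve_left h3
    · intro h
      have key : ∃ k, (k = 0 ∨ k = n - 2) ∧ ∀ x ∈ W, x.1 = k := by
        rcases h with h | h
        · exact ⟨0, Or.inl rfl, fun x hx => by simpa [Fin.ext_iff] using h hx⟩
        · exact ⟨n - 2, Or.inr rfl, fun x hx => by simpa [Fin.ext_iff] using h hx⟩
      obtain ⟨k, hk, hWk⟩ := key
      have hWk' : ∀ x ∈ insert (⟨n - 1, by omega⟩ : Fin n) W, x.1 = n - 1 ∨ x.1 = k := by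
        intro x hx
        rcases Finset.mem_insert.1 hx with rfl | hx
        · exact Or.inl rfl
        · exact Or.inr (hWk x hx)
      refine ⟨fun hx => ?_, fun a ha b hb => ?_⟩
      · have := hWk _ hx
        dsimp only at this
        omega
      · have := hWk' a ha
        have := hWk' b hb
        rw [CircClose]
        omega
  · intro W
    rw [mem_deletion, mem_circComplex]
    constructor
    · rintro ⟨h1, h2⟩ a ha
      have key : ∀ x ∈ W, x.1 < n - 1 := by
        intro x hx
        have : x.1 ≠ n - 1 := fun h => h2 (by
          convert hx
          exact h.symm)
        omega
      refine ⟨key a ha, fun b hb => ?_⟩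
      have := h1 a ha b hb
      have := key a ha
      have := key b hb
      rw [CircClose] at *
      omega
    · intro h
      refine ⟨fun a ha b hb => ?_, fun h' => lt_irrefl _ (h _ h').1⟩
      have := (h a ha).2 b hb
      have := (h b hb).2 a ha
      rw [CircClose]
      omega

end SimpleGraph

/-! ### The winding cocycle and nonvanishing first homology -/

namespace SimpleGraph

open FinSimplicialComplex

section Winding

variable (K : Type*) [Field K] (n d : ℕ)

/-- The winding cochain: it takes the value `1` on the pairs `{a < b}` for which the short way
from `b` to `a` passes from `n - 1` to `0`. -/
noncomputable def winding : (Finset (Fin n) →₀ K) →ₗ[K] K :=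
  open Classical in
  Finsupp.linearCombination K fun F => if ∃ a ∈ F, ∃ b ∈ F, a.1 + n ≤ b.1 + d then (1 : K) else 0

variable {n d}

open Classical in
theorem winding_single (F : Finset (Fin n)) (x : K) : winding K n d (Finsupp.single F x) =
    if ∃ a ∈ F, ∃ b ∈ F, a.1 + n ≤ b.1 + d then x else 0 := by
  rw [winding, Finsupp.linearCombination_single]
  split_ifs <;> simp

theorem boundary_pair {a b : Fin n} (hab : a < b) : boundary K (Finsupp.single {a, b} 1) =
    Finsupp.single {b} 1 - Finsupp.single {a} 1 := by
  have h1 : ({a, b} : Finset (Fin n)).erase a = {b} := by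
    rw [Finset.erase_insert]
    simpa using hab.ne
  have h2 : ({a, b} : Finset (Fin n)).erase b = {a} := by
    rw [Finset.pair_comm, Finset.erase_insert]
    simpa using hab.ne'
  rw [boundary_single, Finset.sum_pair hab.ne, h1, h2]
  simp [Finset.filter_insert, Finset.filter_singleton, hab, hab.not_gt, sub_eq_add_neg]

theorem exists_lt_lt_of_card_eq_three {V : Type*} [LinearOrder V] {T : Finset V}
    (hT : T.card = 3) : ∃ a b c, a < b ∧ b < c ∧ T = {a, b, c} := by
  refine ⟨T.orderEmbOfFin hT 0, T.orderEmbOfFin hT 1, T.orderEmbOfFin hT 2, by simp, by simp, ?_⟩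
  rw [← Finset.coe_inj, ← Finset.range_orderEmbOfFin T hT]
  ext x
  simp only [Set.mem_range, Finset.coe_insert, Finset.coe_singleton, Set.mem_insert_iff,
    Set.mem_singleton_iff]
  constructor
  · rintro ⟨i, rfl⟩
    fin_cases i <;> simp
  · rintro (rfl | rfl | rfl) <;> exact ⟨_, rfl⟩

theorem boundary_triple {a b c : Fin n} (hab : a < b) (hbc : b < c) :
    boundary K (Finsupp.single {a, b, c} 1) =
      Finsupp.single {b, c} 1 - Finsupp.single {a, c} 1 + Finsupp.single {a, b} 1 := by
  have hac := hab.trans hbc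
  have h1 : ({a, b, c} : Finset (Fin n)).erase a = {b, c} := by
    ext x; simp; grind
  have h2 : ({a, b, c} : Finset (Fin n)).erase b = {a, c} := by
    ext x; simp; grind
  have h3 : ({a, b, c} : Finset (Fin n)).erase c = {a, b} := by
    ext x; simp; grind
  have hb : b ∉ ({c} : Finset (Fin n)) := by simpa using hbc.ne
  have ha : a ∉ ({b, c} : Finset (Fin n)) := by simp [hab.ne, hac.ne]
  rw [boundary_single, Finset.sum_insert ha, Finset.sum_insert hb, Finset.sum_singleton, h1, h2, h3]
  simp [Finset.filter_insert, Finset.filter_singleton, hab, hbc, hac, hab.not_gt, hbc.not_gt,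
    hac.not_gt, hab.ne]
  abel

/-- The winding cochain is a cocycle. -/
theorem winding_boundary (h : 3 * d < n) {c : Finset (Fin n) →₀ K}
    (hc : c ∈ chains K (circComplex n d) 2) : winding K n d (boundary K c) = 0 := by
  rw [chains, Finsupp.mem_supported] at hc
  rw [← Finsupp.sum_single c, Finsupp.sum, map_sum, map_sum]
  refine Finset.sum_eq_zero fun T hT => ?_
  obtain ⟨hT1, hT2⟩ := hc hT
  obtain ⟨x, y, z, hxy, hyz, rfl⟩ := exists_lt_lt_of_card_eq_three (T := T) (by omega)
  rw [mem_circComplex] at hT1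
  have h1 := hT1 x (by simp) y (by simp)
  have h2 := hT1 y (by simp) z (by simp)
  have h3 := hT1 x (by simp) z (by simp)
  rw [← mul_one (c _), ← smul_eq_mul, ← Finsupp.smul_single, map_smul, map_smul,
    boundary_triple K hxy hyz, map_add, map_sub, winding_single, winding_single, winding_single]
  have key : ∀ {a b : Fin n}, a < b → ((∃ u ∈ ({a, b} : Finset (Fin n)),
      ∃ v ∈ ({a, b} : Finset (Fin n)), u.1 + n ≤ v.1 + d) ↔ a.1 + n ≤ b.1 + d) := by
    intro a b hab
    rw [Fin.lt_def] at hab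
    simp only [Finset.mem_insert, Finset.mem_singleton, exists_eq_or_imp, exists_eq_left]
    omega
  -- A close pair either wraps (difference at least n - d) or does not (difference at most d). As n
  -- - d > 2d, the pair x, z wraps exactly when one of x, y and y, z does, and never both of these
  -- wrap; the signed sum is 0.
  simp only [key hxy, key hyz, key (hxy.trans hyz)]
  simp only [CircClose] at h1 h2 h3
  rw [Fin.lt_def] at hxy hyz
  split_ifs <;> first | omega | simp

/-- If `n > 3 * d` and `d ≥ 2`, the first homology does not vanish. -/
theorem not_isCohenMacaulay_circComplex (h : 3 * d < n) (hd : 2 ≤ d) :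
    ¬ (circComplex n d).IsCohenMacaulay K := by
  rintro ⟨-, hCM⟩
  have hlink : ∀ G, G ∈ ((circComplex n d).link ∅ (circComplex n d).empty_mem).faces ↔
      G ∈ (circComplex n d).faces := by
    intro G
    simp [mem_link]
  have hL : (circComplex n d).link ∅ (circComplex n d).empty_mem = circComplex n d :=
    FinSimplicialComplex.ext (Finset.ext hlink)
  -- An arc has d + 1 ≥ 3 elements, so degree 1 is below the dimension.
  have hvan := hCM ∅ (circComplex n d).empty_mem 1 (by
    have h1 := Finset.le_sup (f := Finset.card) ((hlink _).2 (arc_mem_circComplex ⟨0, by omega⟩))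
    rw [card_arc (by omega)] at h1
    rw [dim]
    omega)
  rw [hL, subsingleton_reducedHomology_iff] at hvan
  obtain ⟨m, rfl⟩ : ∃ m, n = m + 1 := ⟨n - 1, by omega⟩
  -- the edges of the cycle
  let e : ℕ → (Finset (Fin (m + 1)) →₀ K) := fun i =>
    if hi : i < m then Finsupp.single {⟨i, by omega⟩, ⟨i + 1, by omega⟩} 1 else 0
  let f : Finset (Fin (m + 1)) →₀ K := Finsupp.single {⟨0, by omega⟩, ⟨m, by omega⟩} 1
  have hbd : ∀ k, k ≤ m → ∀ hk : k < m + 1, boundary K (∑ i ∈ Finset.range k, e i) =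
      Finsupp.single {⟨k, hk⟩} 1 - Finsupp.single {⟨0, by omega⟩} 1 := by
    intro k
    induction k with
    | zero => intros; simp
    | succ k ih =>
      intro hk hk'
      have hkm : k < m := hk
      rw [Finset.sum_range_succ, map_add, ih (by omega) (by omega)]
      simp only [e, dif_pos hkm]
      rw [boundary_pair K (by rw [Fin.lt_def]; dsimp only; omega)]
      abel
  have hchain : ∀ a b : Fin (m + 1), a < b → CircClose (m + 1) d a b →
      Finsupp.single {a, b} (1 : K) ∈ chains K (circComplex (m + 1) d) 1 := by
    intro a b hab hclose
    refine Finsupp.single_mem_supported K _ ⟨?_, ?_⟩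
    · rw [mem_circComplex]
      rw [CircClose] at hclose
      intro x hx y hy
      simp only [Finset.mem_insert, Finset.mem_singleton] at hx hy
      rw [CircClose]
      rcases hx with rfl | rfl <;> rcases hy with rfl | rfl <;> omega
    · rw [Finset.card_pair hab.ne]
      norm_num
  -- The path from 0 to m has boundary {m} - {0}, equal to that of the closing edge f.
  have hz : (∑ i ∈ Finset.range m, e i) - f ∈ cycles K (circComplex (m + 1) d) 1 := by
    refine ⟨Submodule.sub_mem _ (Submodule.sum_mem _ fun i hi => ?_) ?_, ?_⟩
    · have him : i < m := Finset.mem_range.1 hi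
      simp only [e, dif_pos him]
      refine hchain _ _ (by rw [Fin.lt_def]; dsimp only; omega) ?_
      simp only [CircClose]
      omega
    · refine hchain _ _ (by rw [Fin.lt_def]; dsimp only; omega) ?_
      simp only [CircClose]
      omega
    · rw [SetLike.mem_coe, LinearMap.mem_ker, map_sub, hbd m le_rfl (by omega),
        boundary_pair K (by rw [Fin.lt_def]; dsimp only; omega), sub_self]
  obtain ⟨c, hc, hcz⟩ := hvan hz
  -- A boundary has winding 0. But no `e i` wraps and f does, so the winding of this cycle is -1.
  have hw := winding_boundary K h hc
  rw [hcz, map_sub, map_sum, Finset.sum_eq_zero, zero_sub, winding_single, if_pos] at hw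
  · simp at hw
  · refine ⟨⟨0, by omega⟩, by simp, ⟨m, by omega⟩, by simp, ?_⟩
    dsimp only
    omega
  · intro i hi
    have him : i < m := Finset.mem_range.1 hi
    simp only [e, dif_pos him]
    rw [winding_single, if_neg]
    simp only [Finset.mem_insert, Finset.mem_singleton, exists_eq_or_imp, exists_eq_left]
    omega

end Winding

theorem three_mul_lt_or_eq_of_isPure {n d : ℕ} (hn : 2 * d + 2 ≤ n)
    (h : (circComplex n d).IsPure) : 3 * d < n ∨ n = 2 * d + 2 := by
  by_contra! h'
  exact not_isPure_circComplex (by omega) h'.1 h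

end SimpleGraph

/-! ### The equivalences -/

theorem theorem3p3 {K : Type*} [Field K] (n d : ℕ) (hn : 2 * d + 2 ≤ n) (hd : 1 ≤ d)
    (G : SimpleGraph (Fin n)) (hG : G = SimpleGraph.circulant n (Set.Icc (d + 1) (n / 2))) :
    List.TFAE [
      G.independenceComplex.IsBuchsbaum K,
      G.IsWellCovered,
      3 * d < n ∨ n = 2 * d + 2] ∧
    (G.independenceComplex.IsVertexDecomposable ↔ n = 2 * d + 2 ∨ (d = 1 ∧ 3 < n)) ∧
    (G.independenceComplex.IsShellable ↔ n = 2 * d + 2 ∨ (d = 1 ∧ 3 < n)) ∧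
    (G.independenceComplex.IsCohenMacaulay K ↔ n = 2 * d + 2 ∨ (d = 1 ∧ 3 < n)) := by
  subst hG
  have hVD : n = 2 * d + 2 ∨ (d = 1 ∧ 3 < n) →
      (SimpleGraph.circComplex n d).IsVertexDecomposable := by
    rintro (rfl | ⟨rfl, h⟩)
    · exact SimpleGraph.isVertexDecomposable_crossPolytope d
    · exact SimpleGraph.isVertexDecomposable_cycle h
  have hSh : (SimpleGraph.circComplex n d).IsVertexDecomposable →
      (SimpleGraph.circComplex n d).IsShellable := fun h => h.isShellable
  have hCM : (SimpleGraph.circComplex n d).IsShellable →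
      (SimpleGraph.circComplex n d).IsCohenMacaulay K := fun h => h.isCohenMacaulay
  have hnum : (SimpleGraph.circComplex n d).IsCohenMacaulay K →
      n = 2 * d + 2 ∨ (d = 1 ∧ 3 < n) := by
    intro h
    by_contra! h'
    have h3 := (SimpleGraph.three_mul_lt_or_eq_of_isPure hn h.1).resolve_right h'.1
    -- For d = 1 the bound `hn` already gives n ≥ 4, so d ≥ 2 remains and the winding argument
    -- applies.
    have hd1 : d ≠ 1 := fun hd1 => absurd (h'.2 hd1) (by omega)
    exact SimpleGraph.not_isCohenMacaulay_circComplex K h3 (by omega) h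
  refine ⟨?_, ⟨fun h => hnum (hCM (hSh h)), hVD⟩, ⟨fun h => hnum (hCM h), fun h => hSh (hVD h)⟩,
    hnum, fun h => hCM (hSh (hVD h))⟩
  tfae_have 1 → 2 := fun h => SimpleGraph.isWellCovered_iff_isPure.2 h.1
  tfae_have 2 → 3 := fun h =>
    SimpleGraph.three_mul_lt_or_eq_of_isPure hn (SimpleGraph.isWellCovered_iff_isPure.1 h)
  tfae_have 3 → 1 := by
    rintro (h | rfl)
    · exact ⟨SimpleGraph.circComplex_isPure h, fun x hx =>
        (SimpleGraph.isShellable_link_circComplex h x hx).isCohenMacaulay⟩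
    · exact ⟨(hVD (Or.inl rfl)).isShellable.1, fun x hx =>
        (SimpleGraph.isVertexDecomposable_link_crossPolytope hx).isShellable.isCohenMacaulay⟩
  tfae_finish
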